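/- Let $F:\mathbb{R}^3\to\mathbb{R}$ be $C^\infty$, let $\Gamma=\{x: F(x)=0\}$ be compact, and suppose $\nabla F\neq 0$ at every point of $\Gamma$. Let $r_\Gamma$ be the reach of $\Gamma$, that is, the supremum of all $r\ge 0$ such that every $x\in\mathbb{R}^3$ at distance at most $r$ from $\Gamma$ has exactly one closest point in $\Gamma$. Let $\kappa_1(x),\kappa_2(x)$ be the principal curvatures of $\Gamma$ at $x\in\Gamma$ (the eigenvalues, with multiplicity, of the Weingarten map $v\mapsto -Dn(x)v$ on the tangent plane, where $n=\nabla F/\|\nabla F\|$), and set $K_\Gamma=\frac12\max_{x\in\Gamma}\big(|\kappa_1(x)|+|\kappa_2(x)|\big)$. Let $d(x,\Gamma)$ be the signed distance to $\Gamma$, positive where $F>0$ and negative where $F<0$. Let $A,B\in\mathbb{R}^3$ and $h=\|A-B\|$, and suppose $h<r_\Gamma$ and $hK_\Gamma\le \frac14$. If the line segment $AB$ (endpoints included) meets $\Gamma$ in at least two distinct points, then $$\max\{|d(A,\Gamma)|,\,|d(B,\Gamma)|\}\le K_\Gamma h^2 .$$ -/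

import Mathlib

open scoped ContDiff ENNReal

noncomputable section

/-- Euclidean three-space. -/
abbrev E3 : Type := EuclideanSpace ℝ (Fin 3)

/-- The zero level set `{x | F x = 0}`. -/
def zeroSet (F : E3 → ℝ) : Set E3 := {x | F x = 0}

/-- `M` has unique nearest points up to distance `r`: every `x` with `d(x, M) ≤ r` has exactly one
closest point in `M`. -/
def UniqueProjectionUpTo (M : Set E3) (r : ℝ≥0∞) : Prop :=
  ∀ x : E3, Metric.infEDist x M ≤ r → ∃! y : E3, y ∈ M ∧ edist x y = Metric.infEDist x M

/-- The reach of `M` (possibly infinite). -/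
def reach (M : Set E3) : ℝ≥0∞ := sSup {r : ℝ≥0∞ | UniqueProjectionUpTo M r}

/-- The unit normal field `∇F / ‖∇F‖`, defined wherever `∇F ≠ 0`; on the zero set of `F` it is the
normal pointing out of `{F ≤ 0}`. -/
def unitNormal (F : E3 → ℝ) (x : E3) : E3 := ‖gradient F x‖⁻¹ • gradient F x

/-- `κ 0, κ 1` are the principal curvatures, with multiplicity, of the level set of `F` through `x`:
the tangent plane `(∇F x)ᗮ` has an orthonormal basis `e 0, e 1` of eigenvectors of the
Weingarten map `v ↦ -(D n)(x) v`, `n` being the unit normal, with eigenvalues `κ 0, κ 1`. -/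
def ArePrincipalCurvatures (F : E3 → ℝ) (x : E3) (κ : Fin 2 → ℝ) : Prop :=
  ∃ e : Fin 2 → E3, Orthonormal ℝ e ∧ (∀ i, inner ℝ (gradient F x) (e i) = 0) ∧
    ∀ i, -(fderiv ℝ (unitNormal F) x (e i)) = κ i • e i

/-- `K_Γ`: one half of the maximum over `x ∈ Γ = {F = 0}` of `|κ₁(x)| + |κ₂(x)|`. -/
def curvatureBound (F : E3 → ℝ) : ℝ :=
  (1 / 2) * sSup {s : ℝ | ∃ x ∈ zeroSet F, ∃ κ : Fin 2 → ℝ,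
    ArePrincipalCurvatures F x κ ∧ s = |κ 0| + |κ 1|}

/-- The signed distance to `{F = 0}`: positive where `F > 0`, negative where `F < 0`. -/
def signedDistance (F : E3 → ℝ) (x : E3) : ℝ :=
  Real.sign (F x) * Metric.infDist x (zeroSet F)

end

/-!
Let `d` be the signed distance to `Γ = {F = 0}`, `n` the unit normal, `u = B - A`, `K` the
curvature bound, and `g t = d (A + t u)` for `t ∈ [0, 1]`.

Every point of the segment is within `‖u‖`, hence less than the reach, of `Γ`, so it has a unique
nearest point. The nearest-point projection `π` is therefore continuous at the points of the
segment (`continuousAt_nearest`), and satisfies `x = π x + d(x) n(π x)` (`sub_nearest_eq`). The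
inverse function theorem, applied to `(y, l) ↦ (y + l n(y), F y)`, makes `π` and `d` differentiable
there (`differentiableAt_nearest_signedDistance`), and differentiating the identity gives
`∇d = n ∘ π`, so that `g'' = ⟪Dn (Dπ u), u⟫`. In an eigenbasis of the Weingarten map this second
derivative has the eigenvalues `k / (1 + d k)`, where `|k| ≤ 2K`. As `‖u‖ K ≤ 1 / 4`, this gives
`|g''| ≤ 4 K ‖u‖²` everywhere. The factor `4` is too large for the claim, but it improves to `2` on
the side on which it matters: `g'' ≤ 2 K ‖u‖²` where `g ≥ 0`, and `-g'' ≤ 2 K ‖u‖²` where `g ≤ 0`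
(`exists_second_deriv_signedDistance`).

What remains is an estimate for functions of one variable with two zeros
(`left_value_le_of_two_zeros`): the coarse bound is used only between two zeros, to control the
slope at the first zero, and the sharp one from `0` to the first zero. It bounds `|g 0|` by
`K ‖u‖²`; reversing the segment gives the other endpoint.
-/

/-! ### Second-order estimates on an interval -/

/-- Move the base point: the expansion `f t + f' t (b - t) + M / 2 (b - t) ^ 2` of `f b` at `t`
is antitone in `t`, because the terms in `f' t` cancel in its derivative. -/
lemma le_taylor_of_deriv2_le {f f' f'' : ℝ → ℝ} {a b M : ℝ} (hab : a ≤ b)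
    (hf : ∀ t ∈ Set.Icc a b, HasDerivAt f (f' t) t)
    (hf' : ∀ t ∈ Set.Icc a b, HasDerivAt f' (f'' t) t)
    (hM : ∀ t ∈ Set.Icc a b, f'' t ≤ M) :
    f b ≤ f a + f' a * (b - a) + M / 2 * (b - a) ^ 2 := by
  have hd : ∀ t ∈ Set.Icc a b,
      HasDerivAt (fun t => f t + f' t * (b - t) + M / 2 * (b - t) ^ 2)
        ((f'' t - M) * (b - t)) t := by
    intro t ht
    have h1 : HasDerivAt (fun t => b - t) (-1) t := by
      simpa using (hasDerivAt_id t).const_sub b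
    refine (((hf t ht).fun_add ((hf' t ht).fun_mul h1)).fun_add
      ((h1.fun_pow 2).const_mul (M / 2))).congr_deriv ?_
    push_cast
    ring
  have hanti := antitoneOn_of_deriv_nonpos (convex_Icc a b)
    (fun t ht => (hd t ht).continuousAt.continuousWithinAt)
    (fun t ht => (hd t (interior_subset ht)).differentiableAt.differentiableWithinAt)
    (fun t ht => by
      rw [(hd t (interior_subset ht)).deriv]
      exact mul_nonpos_of_nonpos_of_nonneg (by linarith [hM t (interior_subset ht)])
        (by linarith [(interior_subset ht).2]))
  have := hanti (Set.left_mem_Icc.2 hab) (Set.right_mem_Icc.2 hab) hab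
  simpa using this

/-- The expansion at the right endpoint, by reflection of the interval. -/
lemma le_taylor_of_deriv2_le' {f f' f'' : ℝ → ℝ} {a b M : ℝ} (hab : a ≤ b)
    (hf : ∀ t ∈ Set.Icc a b, HasDerivAt f (f' t) t)
    (hf' : ∀ t ∈ Set.Icc a b, HasDerivAt f' (f'' t) t)
    (hM : ∀ t ∈ Set.Icc a b, f'' t ≤ M) :
    f a ≤ f b - f' b * (b - a) + M / 2 * (b - a) ^ 2 := by
  have hmem : ∀ t ∈ Set.Icc (-b) (-a), -t ∈ Set.Icc a b := fun t ht =>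
    ⟨by linarith [ht.2], by linarith [ht.1]⟩
  have := le_taylor_of_deriv2_le (f := fun t => f (-t)) (f' := fun t => -f' (-t))
    (f'' := fun t => f'' (-t)) (a := -b) (b := -a) (M := M) (by linarith)
    (fun t ht => by
      simpa [Function.comp_def] using (hf (-t) (hmem t ht)).comp t (hasDerivAt_neg t))
    (fun t ht => by
      simpa [Function.comp_def] using ((hf' (-t) (hmem t ht)).comp t (hasDerivAt_neg t)).fun_neg)
    (fun t ht => hM _ (hmem t ht))
  simp only [neg_neg] at this
  nlinarith [this]

/-- The bound `g'' ≤ 4M` on all of `[0, 1]` controls the slope at the first zero, through a later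
zero; the bound `g'' ≤ 2M` where `g ≥ 0` controls `g` up to the first zero. With the
first zero at `p` and another one at `q`, together they give `g 0 ≤ M p ^ 2 + 2 M p (q - p)`. -/
lemma left_value_le_of_two_zeros {g g' g'' : ℝ → ℝ} {M p q : ℝ} (hM0 : 0 ≤ M)
    (hg : ∀ t ∈ Set.Icc (0 : ℝ) 1, HasDerivAt g (g' t) t)
    (hg' : ∀ t ∈ Set.Icc (0 : ℝ) 1, HasDerivAt g' (g'' t) t)
    (h4 : ∀ t ∈ Set.Icc (0 : ℝ) 1, g'' t ≤ 4 * M)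
    (h2 : ∀ t ∈ Set.Icc (0 : ℝ) 1, 0 ≤ g t → g'' t ≤ 2 * M)
    (hp : p ∈ Set.Icc (0 : ℝ) 1) (hq : q ∈ Set.Icc (0 : ℝ) 1) (hpq : p < q)
    (hgp : g p = 0) (hgq : g q = 0) : g 0 ≤ M := by
  by_cases h0 : g 0 ≤ 0
  · linarith
  push Not at h0
  have hcont : ContinuousOn g (Set.Icc 0 1) := fun t ht => (hg t ht).continuousAt.continuousWithinAt
  -- the first zero of `g`
  have hZ : IsCompact (Set.Icc (0 : ℝ) 1 ∩ g ⁻¹' {0}) :=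
    isCompact_Icc.of_isClosed_subset
      (hcont.preimage_isClosed_of_isClosed isClosed_Icc isClosed_singleton) Set.inter_subset_left
  obtain ⟨s, ⟨hs, hgs⟩, hmin⟩ := hZ.exists_isLeast ⟨p, hp, hgp⟩
  have hsp : s ≤ p := hmin ⟨hp, hgp⟩
  have hnonneg : ∀ t ∈ Set.Icc 0 s, 0 ≤ g t := by
    intro t ht
    by_contra! hlt
    obtain ⟨c, hc, hgc⟩ := intermediate_value_Icc' ht.1
      (hcont.mono (Set.Icc_subset_Icc_right (ht.2.trans hs.2))) ⟨hlt.le, h0.le⟩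
    have hsc : s ≤ c := hmin ⟨⟨hc.1, hc.2.trans (ht.2.trans hs.2)⟩, hgc⟩
    have : t = s := le_antisymm ht.2 (hsc.trans hc.2)
    rw [this] at hlt
    exact hlt.ne hgs
  have hsub1 : Set.Icc s q ⊆ Set.Icc 0 1 := Set.Icc_subset_Icc hs.1 hq.2
  have hsub2 : Set.Icc 0 s ⊆ Set.Icc 0 1 := Set.Icc_subset_Icc le_rfl hs.2
  have hsq : s < q := hsp.trans_lt hpq
  have e1 := le_taylor_of_deriv2_le hsq.le (fun t ht => hg t (hsub1 ht))
    (fun t ht => hg' t (hsub1 ht)) (fun t ht => h4 t (hsub1 ht))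
  have e2 := le_taylor_of_deriv2_le' hs.1 (fun t ht => hg t (hsub2 ht))
    (fun t ht => hg' t (hsub2 ht)) (fun t ht => h2 t (hsub2 ht) (hnonneg t ht))
  have hgs' : g s = 0 := hgs
  rw [hgq, hgs'] at e1
  rw [hgs'] at e2
  have e3 : 0 ≤ g' s + 2 * M * (q - s) := by
    have : 0 ≤ (g' s + 2 * M * (q - s)) * (q - s) := by nlinarith
    exact nonneg_of_mul_nonneg_left this (by linarith)
  have e4 : g 0 ≤ 2 * M * (q - s) * s + M * s ^ 2 := by
    nlinarith [mul_nonneg e3 hs.1]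
  have e5 : 2 * (q - s) * s + s ^ 2 ≤ 1 := by nlinarith [hq.1, hq.2, sq_nonneg (q - s)]
  nlinarith

/-! ### The unit normal and the principal curvatures -/

section Normal

variable {F : E3 → ℝ}

lemma contDiff_gradient (hF : ContDiff ℝ ∞ F) : ContDiff ℝ ∞ (gradient F) := by
  have h : ContDiff ℝ ∞ (fderiv ℝ F) := hF.fderiv_right (by simp)
  exact (InnerProductSpace.toDual ℝ E3).symm.contDiff.comp h

lemma contDiffAt_unitNormal (hF : ContDiff ℝ ∞ F) {x : E3} (hx : gradient F x ≠ 0) :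
    ContDiffAt ℝ ∞ (unitNormal F) x := by
  have h := (contDiff_gradient hF).contDiffAt (x := x)
  exact ((h.norm ℝ hx).inv (norm_ne_zero_iff.2 hx)).smul h

lemma norm_unitNormal {x : E3} (hx : gradient F x ≠ 0) : ‖unitNormal F x‖ = 1 := by
  rw [unitNormal, norm_smul, norm_inv, norm_norm, inv_mul_cancel₀ (norm_ne_zero_iff.2 hx)]

lemma inner_unitNormal {x w : E3} :
    inner ℝ (unitNormal F x) w = ‖gradient F x‖⁻¹ * inner ℝ (gradient F x) w := by
  rw [unitNormal, real_inner_smul_left]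

lemma inner_unitNormal_eq_zero {x w : E3} (hw : inner ℝ (gradient F x) w = 0) :
    inner ℝ (unitNormal F x) w = 0 := by
  rw [inner_unitNormal, hw, mul_zero]

lemma inner_unitNormal_fderiv (hF : ContDiff ℝ ∞ F) {x : E3} (hx : gradient F x ≠ 0) (v : E3) :
    inner ℝ (unitNormal F x) (fderiv ℝ (unitNormal F) x v) = 0 := by
  have hn := ((contDiffAt_unitNormal hF hx).differentiableAt (by simp)).hasFDerivAt
  have h1 := hn.inner ℝ hn
  have hev : (fun y => inner ℝ (unitNormal F y) (unitNormal F y)) =ᶠ[nhds x] fun _ => (1 : ℝ) := by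
    filter_upwards [(contDiff_gradient hF).continuous.continuousAt.eventually_ne hx] with y hy
    rw [real_inner_self_eq_norm_sq, norm_unitNormal hy, one_pow]
  have h2 := (h1.congr_of_eventuallyEq hev.symm).unique (hasFDerivAt_const (1 : ℝ) x)
  have h3 := congrArg (fun L => L v) h2
  simp [real_inner_comm] at h3
  linarith

lemma inner_gradient_fderiv_unitNormal (hF : ContDiff ℝ ∞ F) {x : E3} (hx : gradient F x ≠ 0)
    (v : E3) : inner ℝ (gradient F x) (fderiv ℝ (unitNormal F) x v) = 0 := by
  have h := inner_unitNormal_fderiv hF hx v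
  rw [inner_unitNormal] at h
  exact (mul_eq_zero.1 h).resolve_left (inv_ne_zero (norm_ne_zero_iff.2 hx))

/-- The second fundamental form is the Hessian of `F` divided by `‖∇F‖`. -/
lemma inner_fderiv_unitNormal (hF : ContDiff ℝ ∞ F) {x : E3} (hx : gradient F x ≠ 0) (v w : E3)
    (hw : inner ℝ (gradient F x) w = 0) :
    inner ℝ (fderiv ℝ (unitNormal F) x v) w
      = ‖gradient F x‖⁻¹ * fderiv ℝ (fderiv ℝ F) x v w := by
  have hG := (((contDiff_gradient hF).contDiffAt (x := x)).differentiableAt (by simp)).hasFDerivAt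
  have hφ : DifferentiableAt ℝ (fun y => ‖gradient F y‖⁻¹) x :=
    ((((contDiff_gradient hF).contDiffAt (x := x)).norm ℝ hx).inv
      (norm_ne_zero_iff.2 hx)).differentiableAt (by simp)
  have h1 := (hφ.hasFDerivAt.smul hG).fderiv
  have h2 : fderiv ℝ (unitNormal F) x v = ‖gradient F x‖⁻¹ • fderiv ℝ (gradient F) x v
      + (fderiv ℝ (fun y => ‖gradient F y‖⁻¹) x v) • gradient F x := by
    have : unitNormal F = (fun y => ‖gradient F y‖⁻¹) • gradient F := rfl
    rw [this, h1]
    simp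
  have hD : DifferentiableAt ℝ (fderiv ℝ F) x :=
    ((hF.fderiv_right (m := ∞) (by simp)).contDiffAt).differentiableAt (by simp)
  have h3 : fderiv ℝ (gradient F) x v
      = (InnerProductSpace.toDual ℝ E3).symm (fderiv ℝ (fderiv ℝ F) x v) := by
    have := ((InnerProductSpace.toDual ℝ E3).symm.toContinuousLinearEquiv
      |>.hasFDerivAt (x := fderiv ℝ F x)).comp x hD.hasFDerivAt
    have h4 := this.fderiv
    exact congrArg (fun L => L v) h4
  rw [h2, inner_add_left, real_inner_smul_left, real_inner_smul_left, hw, h3]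
  simp

lemma inner_fderiv_unitNormal_comm (hF : ContDiff ℝ ∞ F) {x : E3} (hx : gradient F x ≠ 0)
    {v w : E3} (hv : inner ℝ (gradient F x) v = 0) (hw : inner ℝ (gradient F x) w = 0) :
    inner ℝ (fderiv ℝ (unitNormal F) x v) w = inner ℝ v (fderiv ℝ (unitNormal F) x w) := by
  rw [real_inner_comm _ v, inner_fderiv_unitNormal hF hx v w hw,
    inner_fderiv_unitNormal hF hx w v hv,
    (hF.contDiffAt.isSymmSndFDerivAt
      (by simpa using WithTop.coe_le_coe.2 (le_top (a := (2 : ℕ∞))))).eq v w]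

/-- The spectral theorem for the Weingarten map, with the eigenvalues `k` of `Dn` (the opposites
of the principal curvatures). -/
lemma exists_principal_basis (hF : ContDiff ℝ ∞ F) {x : E3} (hx : gradient F x ≠ 0) :
    ∃ (e : Fin 2 → E3) (k : Fin 2 → ℝ), Orthonormal ℝ e ∧
      (∀ i, inner ℝ (gradient F x) (e i) = 0) ∧
      (∀ i, fderiv ℝ (unitNormal F) x (e i) = k i • e i) ∧
      ∀ w, inner ℝ (gradient F x) w = 0 → w = ∑ i, inner ℝ (e i) w • e i := by
  set T : Submodule ℝ E3 := (Submodule.span ℝ {gradient F x})ᗮ with hT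
  have memT : ∀ w, w ∈ T ↔ inner ℝ (gradient F x) w = 0 := fun w =>
    Submodule.mem_orthogonal_singleton_iff_inner_right
  let S : T →ₗ[ℝ] T := (fderiv ℝ (unitNormal F) x : E3 →ₗ[ℝ] E3).restrict
    (fun v _ => (memT _).2 (inner_gradient_fderiv_unitNormal hF hx v))
  have hS : S.IsSymmetric := fun v w =>
    inner_fderiv_unitNormal_comm hF hx ((memT _).1 v.2) ((memT _).1 w.2)
  have : Fact (Module.finrank ℝ E3 = 2 + 1) := ⟨by simp⟩
  have hdim : Module.finrank ℝ T = 2 := Submodule.finrank_orthogonal_span_singleton hx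
  let b := hS.eigenvectorBasis hdim
  refine ⟨fun i => (b i : E3), hS.eigenvalues hdim, ?_, fun i => (memT _).1 (b i).2, fun i => ?_,
    fun w hw => ?_⟩
  · exact b.orthonormal.comp_linearIsometry T.subtypeₗᵢ
  · exact congrArg Subtype.val (hS.apply_eigenvectorBasis hdim i)
  · have := congrArg Subtype.val (b.sum_repr' (⟨w, (memT w).2 hw⟩ : T)).symm
    simpa using this

lemma curvature_sum_le (hF : ContDiff ℝ ∞ F) (hreg : ∀ x ∈ zeroSet F, gradient F x ≠ 0)
    (hcpt : IsCompact (zeroSet F)) {x : E3} (hx : x ∈ zeroSet F) {κ : Fin 2 → ℝ}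
    (hκ : ArePrincipalCurvatures F x κ) : |κ 0| + |κ 1| ≤ 2 * curvatureBound F := by
  have hcont : ContinuousOn (fderiv ℝ (unitNormal F)) (zeroSet F) := fun y hy =>
    ((contDiffAt_unitNormal hF (hreg y hy)).fderiv_right (m := 0) (by simp)).continuousAt
      |>.continuousWithinAt
  obtain ⟨C, hC⟩ := hcpt.exists_bound_of_continuousOn hcont
  have hbdd : BddAbove {s : ℝ | ∃ x ∈ zeroSet F, ∃ κ : Fin 2 → ℝ,
      ArePrincipalCurvatures F x κ ∧ s = |κ 0| + |κ 1|} := by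
    refine ⟨C + C, ?_⟩
    rintro _ ⟨y, hy, κ, ⟨e, he, -, hκ⟩, rfl⟩
    have key : ∀ i, |κ i| ≤ C := fun i => by
      have h1 := (fderiv ℝ (unitNormal F) y).le_of_opNorm_le (hC y hy) (e i)
      rwa [← norm_neg, hκ i, norm_smul, he.1 i, mul_one, mul_one, Real.norm_eq_abs] at h1
    exact add_le_add (key 0) (key 1)
  have := le_csSup hbdd ⟨x, hx, κ, hκ, rfl⟩
  rw [curvatureBound]
  linarith

lemma abs_eigenvalue_le (hF : ContDiff ℝ ∞ F) (hreg : ∀ x ∈ zeroSet F, gradient F x ≠ 0)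
    (hcpt : IsCompact (zeroSet F)) {x : E3} (hx : x ∈ zeroSet F) {e : Fin 2 → E3} {k : Fin 2 → ℝ}
    (he : Orthonormal ℝ e) (het : ∀ i, inner ℝ (gradient F x) (e i) = 0)
    (hk : ∀ i, fderiv ℝ (unitNormal F) x (e i) = k i • e i) (i : Fin 2) :
    |k i| ≤ 2 * curvatureBound F := by
  have h := curvature_sum_le hF hreg hcpt hx (κ := fun i => -k i)
    ⟨e, he, het, fun i => by rw [hk, neg_smul]⟩
  simp only [abs_neg] at h
  fin_cases i
  · exact (le_add_of_nonneg_right (abs_nonneg _)).trans h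
  · exact (le_add_of_nonneg_left (abs_nonneg _)).trans h

/-! ### Nearest points -/

/-- A vector that has nonnegative inner product with the whole open half-space `⟪a, v⟫ > 0` is a
nonnegative multiple of `a`. -/
lemma eq_smul_of_inner_nonneg {a m : E3} (ha : a ≠ 0)
    (h : ∀ v, 0 < inner ℝ a v → 0 ≤ inner ℝ m v) : ∃ c : ℝ, 0 ≤ c ∧ m = c • a := by
  have haa : 0 < inner ℝ a a := real_inner_self_pos.2 ha
  set c : ℝ := inner ℝ m a / inner ℝ a a with hc
  have hc0 : 0 ≤ c := div_nonneg (h a haa) haa.le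
  refine ⟨c, hc0, ?_⟩
  set p := m - c • a with hp
  have hpa : inner ℝ a p = 0 := by
    rw [hp, inner_sub_right, real_inner_smul_right, real_inner_comm, hc]
    field_simp
    simp
  have hmp : inner ℝ m p = inner ℝ p p := by
    have : m = p + c • a := by rw [hp]; abel
    conv_lhs => rw [this]
    rw [inner_add_left, real_inner_smul_left, hpa]
    simp
  -- test against `ε • a - p` and let `ε → 0`
  have hle : ∀ ε : ℝ, 0 < ε → inner ℝ p p ≤ 0 + ε * 1 * inner ℝ m a := by
    intro ε hε
    have := h (ε • a - p) (by
      rw [inner_sub_right, real_inner_smul_right, hpa, sub_zero]; positivity)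
    rw [inner_sub_right, real_inner_smul_right, hmp] at this
    linarith
  have hpp : inner ℝ p p ≤ (0 : ℝ) := by
    have ht : Filter.Tendsto (fun ε : ℝ => 0 + ε * 1 * inner ℝ m a) (nhdsWithin 0 (Set.Ioi 0))
        (nhds (0 + 0 * 1 * inner ℝ m a)) :=
      (Continuous.tendsto (by fun_prop) 0).mono_left nhdsWithin_le_nhds
    simpa using ge_of_tendsto ht (Filter.eventually_of_mem self_mem_nhdsWithin hle)
  exact sub_eq_zero.1 (inner_self_eq_zero (𝕜 := ℝ).1 (le_antisymm hpp real_inner_self_nonneg))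

/-- `F` keeps its sign on the ball about `x` of radius its distance to the zero set; so at a
nearest point `y`, `F` grows in every direction into that ball, which pins down `∇F y`. -/
lemma sub_nearest_eq (hF : ContDiff ℝ ∞ F) {x y : E3} (hy : y ∈ zeroSet F)
    (hgy : gradient F y ≠ 0) (hxy : Metric.infDist x (zeroSet F) = dist x y) :
    x - y = signedDistance F x • unitNormal F y := by
  by_cases hFx : F x = 0
  · have : Metric.infDist x (zeroSet F) = 0 := Metric.infDist_zero_of_mem hFx
    rw [this] at hxy
    rw [dist_eq_zero.1 hxy.symm, signedDistance, show F y = 0 from hy]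
    simp
  set σ : ℝ := Real.sign (F x) with hσ
  have hσ2 : σ * F x = |F x| ∧ |σ| = 1 := by
    rcases lt_or_gt_of_ne hFx with h | h
    · rw [hσ, Real.sign_of_neg h, abs_of_neg h]; simp
    · rw [hσ, Real.sign_of_pos h, abs_of_pos h]; simp
  have hball : ∀ z ∈ Metric.ball x (dist x y), 0 < σ * F z := by
    intro z hz
    by_contra! hneg
    have hx : x ∈ Metric.ball x (dist x y) := Metric.mem_ball_self (dist_nonneg.trans_lt
      (Metric.mem_ball.1 hz))
    obtain ⟨c, hc, hFc⟩ := (convex_ball x (dist x y)).isPreconnected.intermediate_value hz hx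
      ((hF.continuous.const_mul σ).continuousOn)
      (show (0 : ℝ) ∈ Set.Icc (σ * F z) (σ * F x) from ⟨hneg, by rw [hσ2.1]; positivity⟩)
    have hσ0 : σ ≠ 0 := by intro h0; simpa [h0] using hσ2.2
    have hc0 : c ∈ zeroSet F := (mul_eq_zero.1 hFc).resolve_left hσ0
    have := Metric.infDist_le_dist_of_mem (x := x) hc0
    rw [hxy, dist_comm x c] at this
    exact absurd (Metric.mem_ball.1 hc) (not_lt.2 this)
  have hne : x - y ≠ 0 := by
    intro h0
    rw [sub_eq_zero.1 h0] at hFx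
    exact hFx hy
  have hhalf : ∀ v, 0 < inner ℝ (x - y) v → 0 ≤ inner ℝ (σ • gradient F y) v := by
    intro v hv
    have hd : HasDerivAt (fun t : ℝ => σ * F (y + t • v)) (σ * fderiv ℝ F y v) 0 := by
      have h1 : HasDerivAt (fun t : ℝ => y + t • v) v 0 := by
        simpa using ((hasDerivAt_id (0 : ℝ)).smul_const v).const_add y
      have h2 : HasFDerivAt F (fderiv ℝ F y) (y + (0 : ℝ) • v) := by
        simpa using (hF.differentiable (by simp) y).hasFDerivAt
      exact (h2.comp_hasDerivAt 0 h1).const_mul σ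
    rw [real_inner_smul_left, inner_gradient_left]
    refine ge_of_tendsto hd.tendsto_slope_zero_right ?_
    have hsmall : ∀ᶠ t : ℝ in nhdsWithin 0 (Set.Ioi 0),
        t * ‖v‖ ^ 2 < 2 * inner ℝ (x - y) v := by
      refine nhdsWithin_le_nhds (ContinuousAt.eventually_lt (by fun_prop) (by fun_prop) ?_)
      simpa using hv
    filter_upwards [hsmall, self_mem_nhdsWithin] with t ht ht0
    have ht0 : 0 < t := ht0
    have hin : y + t • v ∈ Metric.ball x (dist x y) := by
      rw [Metric.mem_ball, dist_comm, dist_eq_norm, dist_eq_norm]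
      refine lt_of_pow_lt_pow_left₀ 2 (norm_nonneg _) ?_
      rw [show x - (y + t • v) = (x - y) - t • v by abel, norm_sub_sq_real,
        real_inner_smul_right, norm_smul, Real.norm_of_nonneg ht0.le]
      nlinarith
    have hpos := hball _ hin
    simp only [zero_add, zero_smul, add_zero, show F y = 0 from hy, mul_zero, sub_zero,
      smul_eq_mul]
    positivity
  obtain ⟨c, hc0, hc⟩ := eq_smul_of_inner_nonneg hne hhalf
  have hnorm : ‖gradient F y‖ = c * ‖x - y‖ := by
    have := congrArg norm hc
    rwa [norm_smul, norm_smul, Real.norm_eq_abs, hσ2.2, one_mul, Real.norm_of_nonneg hc0] at this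
  have hcne : c ≠ 0 := by
    rintro rfl
    rw [zero_mul] at hnorm
    exact hgy (norm_eq_zero.1 hnorm)
  have hxn : ‖x - y‖ ≠ 0 := norm_ne_zero_iff.2 hne
  have hscal : ‖x - y‖ * (c * ‖x - y‖)⁻¹ * c = 1 := by field_simp
  rw [signedDistance, unitNormal, hxy, dist_eq_norm, hnorm, ← hσ, smul_smul, mul_assoc σ,
    mul_comm σ, mul_smul, hc, smul_smul, hscal, one_smul]

end Normal

/-! ### Regularity of the nearest-point projection and of the signed distance -/

section Projection

variable {F : E3 → ℝ}

/-- If the nearest point of `x₀` in a compact set is unique, every choice of nearest points is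
continuous at `x₀`. -/
lemma continuousAt_nearest {Γ : Set E3} (hΓ : IsCompact Γ) {π : E3 → E3} (hπ : ∀ x, π x ∈ Γ)
    (hd : ∀ x, Metric.infDist x Γ = dist x (π x)) {x₀ : E3}
    (huniq : ∀ y ∈ Γ, dist x₀ y = Metric.infDist x₀ Γ → y = π x₀) : ContinuousAt π x₀ := by
  refine hΓ.tendsto_nhds_of_unique_mapClusterPt (Filter.Eventually.of_forall hπ) ?_
  intro y hy hcl
  refine huniq y hy ?_
  obtain ⟨U, hU, hUy⟩ := mapClusterPt_iff_ultrafilter.1 hcl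
  have h1 : Filter.Tendsto (fun x => dist x (π x)) U (nhds (dist x₀ y)) :=
    Filter.Tendsto.dist hU hUy
  have h2 : Filter.Tendsto (fun x => dist x (π x)) U (nhds (Metric.infDist x₀ Γ)) := by
    simp_rw [← hd]
    exact ((Metric.continuous_infDist_pt Γ).tendsto x₀).mono_left hU
  exact tendsto_nhds_unique h1 h2

/-- In a principal basis, `I + l Dn` multiplies the coordinates by `1 + l kᵢ`, so it is injective
on the tangent plane as soon as these factors do not vanish. -/
lemma eq_zero_of_add_smul_eq_zero {S : E3 →L[ℝ] E3} {e : Fin 2 → E3} {k : Fin 2 → ℝ} {l : ℝ}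
    (he : Orthonormal ℝ e) (hk : ∀ i, S (e i) = k i • e i) (hl : ∀ i, 0 < 1 + l * k i)
    {w : E3} (hw : w = ∑ i, inner ℝ (e i) w • e i) (h : w + l • S w = 0) : w = 0 := by
  have hcoef : ∀ i, inner ℝ (e i) w = 0 := by
    have h1 : ∑ i, ((1 + l * k i) * inner ℝ (e i) w) • e i = 0 := by
      rw [← h]
      conv_rhs => rw [hw]
      rw [map_sum, Finset.smul_sum, ← Finset.sum_add_distrib]
      refine Finset.sum_congr rfl fun i _ => ?_
      rw [map_smul, hk]
      module
    have h2 := Fintype.linearIndependent_iff.1 he.linearIndependent _ h1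
    exact fun i => (mul_eq_zero.1 (h2 i)).resolve_left (hl i).ne'
  rw [hw]
  simp [hcoef]

/-- The inverse function theorem for `(y, l) ↦ (y + l n(y), F y)`: this map sends
`(π x, signedDistance F x)` to `(x, 0)`. -/
lemma differentiableAt_nearest_signedDistance (hF : ContDiff ℝ ∞ F)
    (hreg : ∀ x ∈ zeroSet F, gradient F x ≠ 0) {π : E3 → E3} (hπ : ∀ x, π x ∈ zeroSet F)
    (hd : ∀ x, Metric.infDist x (zeroSet F) = dist x (π x)) {x₀ : E3} (hcont : ContinuousAt π x₀)
    {e : Fin 2 → E3} {k : Fin 2 → ℝ} (he : Orthonormal ℝ e)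
    (hk : ∀ i, fderiv ℝ (unitNormal F) (π x₀) (e i) = k i • e i)
    (hspan : ∀ w, inner ℝ (gradient F (π x₀)) w = 0 → w = ∑ i, inner ℝ (e i) w • e i)
    (hl : ∀ i, 0 < 1 + signedDistance F x₀ * k i) :
    DifferentiableAt ℝ π x₀ ∧ DifferentiableAt ℝ (signedDistance F) x₀ := by
  have heq : ∀ x, x - π x = signedDistance F x • unitNormal F (π x) := fun x =>
    sub_nearest_eq hF (hπ x) (hreg _ (hπ x)) (hd x)
  have hreg₀ := hreg _ (hπ x₀)
  have hnC := contDiffAt_unitNormal hF hreg₀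
  have hsd : ContinuousAt (signedDistance F) x₀ := by
    have h1 : signedDistance F = fun x => inner ℝ (unitNormal F (π x)) (x - π x) := by
      funext x
      rw [heq, real_inner_smul_right, real_inner_self_eq_norm_sq,
        norm_unitNormal (hreg _ (hπ x))]
      simp
    rw [h1]
    have h2 : ContinuousAt (fun x => unitNormal F (π x)) x₀ :=
      ContinuousAt.comp (g := unitNormal F) hnC.continuousAt hcont
    exact h2.inner (𝕜 := ℝ) (continuousAt_id.sub hcont)
  set G : E3 × ℝ → E3 × ℝ := fun z => (z.1 + z.2 • unitNormal F z.1, F z.1) with hG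
  set z₀ : E3 × ℝ := (π x₀, signedDistance F x₀) with hz₀
  have hγ : ContinuousAt (fun x => (π x, signedDistance F x)) x₀ := hcont.prodMk hsd
  have hGγ : ∀ x, G (π x, signedDistance F x) = (x, 0) := fun x => by
    rw [hG]
    simp only [← heq, show F (π x) = 0 from hπ x]
    simp
  have hn : HasStrictFDerivAt (fun z : E3 × ℝ => unitNormal F z.1)
      ((fderiv ℝ (unitNormal F) (π x₀)).comp (ContinuousLinearMap.fst ℝ E3 ℝ)) z₀ :=
    HasStrictFDerivAt.comp (g := unitNormal F) z₀ (hnC.hasStrictFDerivAt (by simp))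
      hasStrictFDerivAt_fst
  have hFs : HasStrictFDerivAt (fun z : E3 × ℝ => F z.1)
      ((fderiv ℝ F (π x₀)).comp (ContinuousLinearMap.fst ℝ E3 ℝ)) z₀ :=
    HasStrictFDerivAt.comp (g := F) z₀ (hF.contDiffAt.hasStrictFDerivAt (by simp))
      hasStrictFDerivAt_fst
  have hGd := ((hasStrictFDerivAt_fst (𝕜 := ℝ) (p := z₀)).fun_add
    ((hasStrictFDerivAt_snd (𝕜 := ℝ) (p := z₀)).fun_smul hn)).prodMk hFs
  set G' : E3 × ℝ →L[ℝ] E3 × ℝ := _ with hG'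
  change HasStrictFDerivAt G G' z₀ at hGd
  have hG'app : ∀ v μ, G' (v, μ) = (v + (signedDistance F x₀ •
      fderiv ℝ (unitNormal F) (π x₀) v + μ • unitNormal F (π x₀)), fderiv ℝ F (π x₀) v) := by
    intro v μ
    simp [hG', hz₀]
  have hinj : Function.Injective G' := by
    refine (injective_iff_map_eq_zero G').2 ?_
    rintro ⟨v, μ⟩ h0
    rw [hG'app, Prod.mk_eq_zero] at h0
    obtain ⟨h1, h2⟩ := h0
    rw [← inner_gradient_left] at h2
    have hμ : μ = 0 := by
      have := congrArg (fun w => inner ℝ (unitNormal F (π x₀)) w) h1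
      simp only [inner_add_right, real_inner_smul_right, inner_unitNormal_eq_zero h2,
        inner_unitNormal_fderiv hF hreg₀, real_inner_self_eq_norm_sq,
        norm_unitNormal hreg₀, inner_zero_right] at this
      linarith
    rw [hμ, zero_smul, add_zero] at h1
    rw [hμ, eq_zero_of_add_smul_eq_zero he hk hl (hspan v h2) h1]
    rfl
  let L : (E3 × ℝ) ≃L[ℝ] (E3 × ℝ) :=
    (LinearEquiv.ofInjectiveEndo (G' : E3 × ℝ →ₗ[ℝ] E3 × ℝ) hinj).toContinuousLinearEquiv
  have hL : (L : E3 × ℝ →L[ℝ] E3 × ℝ) = G' :=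
    ContinuousLinearMap.ext fun _ => rfl
  rw [← hL] at hGd
  have hinv := (hGd.to_localInverse).hasFDerivAt.differentiableAt
  have hz : G z₀ = (x₀, 0) := hGγ x₀
  rw [hz] at hinv
  have hcomp : DifferentiableAt ℝ (fun x : E3 => hGd.localInverse G L z₀ (x, (0 : ℝ))) x₀ :=
    DifferentiableAt.comp x₀ hinv
      (differentiableAt_id.prodMk (differentiableAt_const (0 : ℝ)))
  have hev : (fun x => (π x, signedDistance F x)) =ᶠ[nhds x₀]
      fun x : E3 => hGd.localInverse G L z₀ (x, (0 : ℝ)) := by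
    filter_upwards [hγ.eventually hGd.eventually_left_inverse] with x hx
    rw [← hGγ, hx]
  have hfin := hcomp.congr_of_eventuallyEq hev
  exact ⟨hfin.fst, hfin.snd⟩

/-- Differentiating `x = π x + d(x) n(π x)` and `F (π x) = 0`: the derivative of the signed
distance is `⟪n ∘ π, ·⟫`, and that of `π` maps into the tangent plane and inverts `I + d Dn`
there. -/
lemma fderiv_nearest_signedDistance (hF : ContDiff ℝ ∞ F)
    (hreg : ∀ x ∈ zeroSet F, gradient F x ≠ 0) {π : E3 → E3} (hπ : ∀ x, π x ∈ zeroSet F)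
    (hd : ∀ x, Metric.infDist x (zeroSet F) = dist x (π x)) {x₀ : E3}
    (hP : DifferentiableAt ℝ π x₀) (hs : DifferentiableAt ℝ (signedDistance F) x₀) (v : E3) :
    inner ℝ (gradient F (π x₀)) (fderiv ℝ π x₀ v) = 0 ∧
      fderiv ℝ (signedDistance F) x₀ v = inner ℝ (unitNormal F (π x₀)) v ∧
      v = fderiv ℝ π x₀ v
        + signedDistance F x₀ • fderiv ℝ (unitNormal F) (π x₀) (fderiv ℝ π x₀ v)
        + (inner ℝ (unitNormal F (π x₀)) v : ℝ) • unitNormal F (π x₀) := by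
  have hreg₀ := hreg _ (hπ x₀)
  have hn := ((contDiffAt_unitNormal hF hreg₀).differentiableAt (by simp)).hasFDerivAt
  have hnπ := hn.comp x₀ hP.hasFDerivAt
  have htan : inner ℝ (gradient F (π x₀)) (fderiv ℝ π x₀ v) = 0 := by
    have h1 := (hF.differentiable (by simp) (π x₀)).hasFDerivAt.comp x₀ hP.hasFDerivAt
    have h2 : F ∘ π = fun _ => (0 : ℝ) := funext fun x => hπ x
    rw [h2] at h1
    have h3 := congrArg (fun L => L v) (h1.unique (hasFDerivAt_const (0 : ℝ) x₀))
    rw [inner_gradient_left]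
    simpa using h3
  have hsum := hP.hasFDerivAt.add (hs.hasFDerivAt.smul hnπ)
  have hid : (π + signedDistance F • (unitNormal F ∘ π)) = id := by
    funext x
    have := sub_nearest_eq hF (hπ x) (hreg _ (hπ x)) (hd x)
    simp only [Pi.add_apply, Pi.smul_apply', Function.comp_apply, ← this, id]
    abel
  rw [hid] at hsum
  have hv := congrArg (fun L => L v) ((hasFDerivAt_id x₀).unique hsum)
  simp only [ContinuousLinearMap.id_apply, add_apply, smul_apply, ContinuousLinearMap.comp_apply,
    ContinuousLinearMap.smulRight_apply, Function.comp_apply] at hv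
  have hL : fderiv ℝ (signedDistance F) x₀ v = inner ℝ (unitNormal F (π x₀)) v := by
    have := congrArg (fun w => inner ℝ (unitNormal F (π x₀)) w) hv
    simp only [inner_add_right, real_inner_smul_right, inner_unitNormal_eq_zero htan,
      inner_unitNormal_fderiv hF hreg₀, real_inner_self_eq_norm_sq,
      norm_unitNormal hreg₀] at this
    linarith
  refine ⟨htan, hL, ?_⟩
  rw [← hL]
  conv_lhs => rw [hv]
  abel

/-- In a principal basis the second derivative of the signed distance, `⟪Dn w, u⟫` with
`u = (I + l Dn) w + c n`, is `∑ kᵢ (1 + l kᵢ) aᵢ²`, whereas `‖u‖² ≥ ∑ (1 + l kᵢ)² aᵢ²`. -/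
lemma inner_le_mul_norm_sq {S : E3 →L[ℝ] E3} {e : Fin 2 → E3} {k : Fin 2 → ℝ} {l M c : ℝ}
    {w u n : E3} (he : Orthonormal ℝ e) (hk : ∀ i, S (e i) = k i • e i)
    (hn : ∀ i, inner ℝ n (e i) = 0)
    (hw : w = ∑ i, inner ℝ (e i) w • e i) (hu : u = w + l • S w + c • n)
    (hl : ∀ i, 0 ≤ 1 + l * k i) (hM : ∀ i, k i ≤ M * (1 + l * k i)) (hM0 : 0 ≤ M) :
    inner ℝ (S w) u ≤ M * ‖u‖ ^ 2 := by
  have hSw : S w = ∑ i, (k i * inner ℝ (e i) w) • e i := by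
    conv_lhs => rw [hw]
    rw [map_sum]
    exact Finset.sum_congr rfl fun i _ => by rw [map_smul, hk]; module
  have hcoord : ∀ i, inner ℝ (e i) u = (1 + l * k i) * inner ℝ (e i) w := by
    intro i
    have h1 : inner ℝ (e i) (S w) = k i * inner ℝ (e i) w := by
      rw [hSw, he.inner_right_fintype]
    rw [hu, inner_add_right, inner_add_right, real_inner_smul_right, real_inner_smul_right, h1,
      real_inner_comm n, hn]
    ring
  have hbessel : ∑ i, (inner ℝ (e i) u : ℝ) ^ 2 ≤ ‖u‖ ^ 2 := by
    simpa using he.sum_inner_products_le (x := u) (s := Finset.univ)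
  calc inner ℝ (S w) u = ∑ i, k i * (1 + l * k i) * (inner ℝ (e i) w) ^ 2 := by
        rw [hSw, sum_inner]
        refine Finset.sum_congr rfl fun i _ => ?_
        rw [real_inner_smul_left, hcoord]
        ring
    _ ≤ ∑ i, M * (inner ℝ (e i) u : ℝ) ^ 2 := by
        refine Finset.sum_le_sum fun i _ => ?_
        rw [hcoord]
        have := mul_le_mul_of_nonneg_right (hM i)
          (mul_nonneg (hl i) (sq_nonneg (inner ℝ (e i) w)))
        nlinarith
    _ = M * ∑ i, (inner ℝ (e i) u : ℝ) ^ 2 := by rw [Finset.mul_sum]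
    _ ≤ M * ‖u‖ ^ 2 := mul_le_mul_of_nonneg_left hbessel hM0

end Projection

/-! ### The signed distance along a segment -/

section Segment

variable {F : E3 → ℝ}

lemma abs_signedDistance_le (x : E3) : |signedDistance F x| ≤ Metric.infDist x (zeroSet F) := by
  rw [signedDistance, abs_mul, abs_of_nonneg Metric.infDist_nonneg]
  refine mul_le_of_le_one_left Metric.infDist_nonneg ?_
  rcases Real.sign_apply_eq (F x) with h | h | h <;> simp [h]

/-- Along a line, the eigenvalues of the second derivative of the signed distance `d` are
`k / (1 + d k)` with `|k| ≤ 2K`. They are at most `4K` in absolute value if `2K |d| ≤ 1 / 2`, and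
where `d ≥ 0` the increasing function `k ↦ k / (1 + d k)` is at most `2K`. -/
lemma exists_second_deriv_signedDistance (hF : ContDiff ℝ ∞ F)
    (hreg : ∀ x ∈ zeroSet F, gradient F x ≠ 0) (hcpt : IsCompact (zeroSet F))
    {π : E3 → E3} (hπ : ∀ x, π x ∈ zeroSet F)
    (hd : ∀ x, Metric.infDist x (zeroSet F) = dist x (π x)) (A u : E3) (t : ℝ)
    (huniq : ∀ y ∈ zeroSet F, dist (A + t • u) y = Metric.infDist (A + t • u) (zeroSet F) →
      y = π (A + t • u))
    (hsmall : |signedDistance F (A + t • u)| * curvatureBound F ≤ 1 / 4) :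
    ∃ s : ℝ, HasDerivAt (fun t => signedDistance F (A + t • u))
        (inner ℝ (unitNormal F (π (A + t • u))) u) t ∧
      HasDerivAt (fun t : ℝ => (inner ℝ (unitNormal F (π (A + t • u))) u : ℝ)) s t ∧
      |s| ≤ 4 * (curvatureBound F * ‖u‖ ^ 2) ∧
      (0 ≤ signedDistance F (A + t • u) → s ≤ 2 * (curvatureBound F * ‖u‖ ^ 2)) ∧
      (signedDistance F (A + t • u) ≤ 0 → -s ≤ 2 * (curvatureBound F * ‖u‖ ^ 2)) := by
  set x₀ : E3 := A + t • u with hx₀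
  set l : ℝ := signedDistance F x₀ with hl
  set K : ℝ := curvatureBound F with hKdef
  have hreg₀ := hreg _ (hπ x₀)
  obtain ⟨e, k, he, het, hk, hspan⟩ := exists_principal_basis hF hreg₀
  have hkK : ∀ i, |k i| ≤ 2 * K := abs_eigenvalue_le hF hreg hcpt (hπ x₀) he het hk
  have hK0 : 0 ≤ K := by linarith [hkK 0, abs_nonneg (k 0)]
  have hlk : ∀ i, |l * k i| ≤ 1 / 2 := fun i => by
    rw [abs_mul]
    nlinarith [mul_le_mul_of_nonneg_left (hkK i) (abs_nonneg l)]
  have hpos : ∀ i, 1 / 2 ≤ 1 + l * k i := fun i => by linarith [(abs_le.1 (hlk i)).1]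
  obtain ⟨hP, hs⟩ := differentiableAt_nearest_signedDistance hF hreg hπ hd
    (continuousAt_nearest hcpt hπ hd huniq) he hk hspan (fun i => by linarith [hpos i])
  obtain ⟨htan, hfd, hu⟩ := fderiv_nearest_signedDistance hF hreg hπ hd hP hs u
  have hline : HasDerivAt (fun t : ℝ => A + t • u) u t := by
    simpa using ((hasDerivAt_id t).smul_const u).const_add A
  have hn := ((contDiffAt_unitNormal hF hreg₀).differentiableAt (by simp)).hasFDerivAt
  have hnl : HasDerivAt (fun t : ℝ => unitNormal F (π (A + t • u)))
      (fderiv ℝ (unitNormal F) (π x₀) (fderiv ℝ π x₀ u)) t := by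
    have hnπ : HasFDerivAt (unitNormal F ∘ π)
        ((fderiv ℝ (unitNormal F) (π x₀)).comp (fderiv ℝ π x₀)) (A + t • u) :=
      hn.comp x₀ hP.hasFDerivAt
    exact hnπ.comp_hasDerivAt t hline
  set S := fderiv ℝ (unitNormal F) (π x₀) with hS
  set w := fderiv ℝ π x₀ u with hw
  have hne : ∀ i, inner ℝ (unitNormal F (π x₀)) (e i) = 0 := fun i =>
    inner_unitNormal_eq_zero (het i)
  have hup : ∀ M : ℝ, 0 ≤ M → (∀ i, k i ≤ M * (1 + l * k i)) → inner ℝ (S w) u ≤ M * ‖u‖ ^ 2 :=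
    fun M hM0 hM => inner_le_mul_norm_sq he hk hne (hspan w htan) hu
      (fun i => by linarith [hpos i]) hM hM0
  have hlow : ∀ M : ℝ, 0 ≤ M → (∀ i, -k i ≤ M * (1 + l * k i)) →
      -inner ℝ (S w) u ≤ M * ‖u‖ ^ 2 := by
    intro M hM0 hM
    -- the same estimate for the opposite orientation of the surface
    have := inner_le_mul_norm_sq (S := -S) (k := fun i => -k i) (l := -l) (M := M) (u := u)
      (c := inner ℝ (unitNormal F (π x₀)) u) he
      (fun i => by rw [neg_apply, hk, neg_smul]) hne (hspan w htan)
      (by rw [neg_apply, neg_smul_neg]; exact hu) (fun i => by linarith [hpos i])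
      (fun i => by simpa using hM i) hM0
    simpa using this
  refine ⟨inner ℝ (S w) u, ?_, ?_, ?_, fun h0 => ?_, fun h0 => ?_⟩
  · rw [← hfd]
    exact hs.hasFDerivAt.comp_hasDerivAt t hline
  · simpa using hnl.inner ℝ (hasDerivAt_const t u)
  · rw [abs_le', ← mul_assoc]
    refine ⟨hup _ (by positivity) fun i => ?_, hlow _ (by positivity) fun i => ?_⟩ <;>
    nlinarith [abs_le.1 (hkK i), hpos i, mul_le_mul_of_nonneg_left (hpos i) hK0]
  · rw [← mul_assoc]
    refine hup _ (by positivity) fun i => ?_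
    rcases le_total 0 (k i) with h | h
    · nlinarith [(abs_le.1 (hkK i)).2, mul_nonneg hK0 (mul_nonneg h0 h)]
    · exact h.trans (mul_nonneg (by positivity) (by linarith [hpos i]))
  · rw [← mul_assoc]
    refine hlow _ (by positivity) fun i => ?_
    rcases le_total 0 (k i) with h | h
    · exact (neg_nonpos.2 h).trans (mul_nonneg (by positivity) (by linarith [hpos i]))
    · nlinarith [(abs_le.1 (hkK i)).1, mul_nonneg hK0 (mul_nonneg_of_nonpos_of_nonpos h0 h)]

lemma abs_signedDistance_left_le (hF : ContDiff ℝ ∞ F)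
    (hreg : ∀ x ∈ zeroSet F, gradient F x ≠ 0) (hcpt : IsCompact (zeroSet F)) (A u : E3)
    (hreach : ENNReal.ofReal ‖u‖ < reach (zeroSet F)) (hK : ‖u‖ * curvatureBound F ≤ 1 / 4)
    {p q : ℝ} (hp : p ∈ Set.Icc (0 : ℝ) 1) (hq : q ∈ Set.Icc (0 : ℝ) 1) (hpq : p < q)
    (hFp : A + p • u ∈ zeroSet F) (hFq : A + q • u ∈ zeroSet F) :
    |signedDistance F A| ≤ curvatureBound F * ‖u‖ ^ 2 := by
  have hne : (zeroSet F).Nonempty := ⟨_, hFp⟩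
  choose π hπ hd using hcpt.exists_infDist_eq_dist hne
  obtain ⟨r, hr, hur⟩ := lt_sSup_iff.1 hreach
  have hclose : ∀ t ∈ Set.Icc (0 : ℝ) 1, Metric.infDist (A + t • u) (zeroSet F) ≤ ‖u‖ := by
    intro t ht
    refine (Metric.infDist_le_dist_of_mem hFp).trans ?_
    rw [dist_eq_norm, add_sub_add_left_eq_sub, ← sub_smul, norm_smul]
    refine mul_le_of_le_one_left (norm_nonneg _) (abs_le.2 ⟨?_, ?_⟩) <;>
    linarith [ht.1, ht.2, hp.1, hp.2]
  have hof : ∀ x, Metric.infEDist x (zeroSet F) = ENNReal.ofReal (Metric.infDist x (zeroSet F)) :=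
    fun x => (ENNReal.ofReal_toReal (Metric.infEDist_ne_top hne)).symm
  have huniq : ∀ t ∈ Set.Icc (0 : ℝ) 1, ∀ y ∈ zeroSet F,
      dist (A + t • u) y = Metric.infDist (A + t • u) (zeroSet F) → y = π (A + t • u) := by
    intro t ht y hy hdy
    have hle : Metric.infEDist (A + t • u) (zeroSet F) ≤ r := by
      rw [hof]
      exact (ENNReal.ofReal_le_ofReal (hclose t ht)).trans hur.le
    refine (hr _ hle).unique ⟨hy, ?_⟩ ⟨hπ _, ?_⟩
    · rw [edist_dist, hof, hdy]
    · rw [edist_dist, hof, hd]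
  have hK0 : 0 ≤ curvatureBound F := by
    obtain ⟨e, k, he, het, hk, -⟩ := exists_principal_basis hF (hreg _ hFp)
    linarith [abs_nonneg (k 0), abs_eigenvalue_le hF hreg hcpt hFp he het hk 0]
  have key : ∀ t, t ∈ Set.Icc (0 : ℝ) 1 → _ := fun t ht =>
    exists_second_deriv_signedDistance hF hreg hcpt hπ hd A u t (huniq t ht)
      ((mul_le_mul_of_nonneg_right ((abs_signedDistance_le _).trans (hclose t ht)) hK0).trans hK)
  choose! g'' h1 h2 h3 h4 h5 using key
  have hzero : ∀ x ∈ zeroSet F, signedDistance F x = 0 := fun x hx => by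
    rw [signedDistance, show F x = 0 from hx, Real.sign_zero, zero_mul]
  have hM : 0 ≤ curvatureBound F * ‖u‖ ^ 2 := by positivity
  have hA : signedDistance F A = signedDistance F (A + (0 : ℝ) • u) := by simp
  rw [abs_le', hA]
  constructor
  · exact left_value_le_of_two_zeros hM h1 h2 (fun t ht => (abs_le.1 (h3 t ht)).2) h4 hp hq hpq
      (hzero _ hFp) (hzero _ hFq)
  · exact left_value_le_of_two_zeros (g := fun t => -signedDistance F (A + t • u)) hM
      (fun t ht => (h1 t ht).fun_neg) (fun t ht => (h2 t ht).fun_neg)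
      (fun t ht => by linarith [(abs_le.1 (h3 t ht)).1])
      (fun t ht h0 => h5 t ht (by linarith)) hp hq hpq
      (by simp [hzero _ hFp]) (by simp [hzero _ hFq])

end Segment

theorem mainTheorem2 (F : E3 → ℝ) (hF : ContDiff ℝ ∞ F)
    (hreg : ∀ x ∈ zeroSet F, gradient F x ≠ 0) (hcpt : IsCompact (zeroSet F))
    (A B : E3) (h : ℝ) (hh : h = ‖A - B‖)
    (hreach : ENNReal.ofReal h < reach (zeroSet F))
    (hK : h * curvatureBound F ≤ 1 / 4)
    (htwice : ∃ P ∈ segment ℝ A B, ∃ Q ∈ segment ℝ A B,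
      P ≠ Q ∧ P ∈ zeroSet F ∧ Q ∈ zeroSet F) :
    max |signedDistance F A| |signedDistance F B| ≤ curvatureBound F * h ^ 2 := by
  have key : ∀ A B : E3, h = ‖B - A‖ → (∃ P ∈ segment ℝ A B, ∃ Q ∈ segment ℝ A B,
      P ≠ Q ∧ P ∈ zeroSet F ∧ Q ∈ zeroSet F) →
      |signedDistance F A| ≤ curvatureBound F * h ^ 2 := by
    rintro A B hAB ⟨P, hP, Q, hQ, hne, hFP, hFQ⟩
    rw [segment_eq_image'] at hP hQ
    obtain ⟨p, hp, rfl⟩ := hP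
    obtain ⟨q, hq, rfl⟩ := hQ
    subst hAB
    rcases lt_or_gt_of_ne (fun hpq : p = q => hne (by rw [hpq])) with hlt | hlt
    · exact abs_signedDistance_left_le hF hreg hcpt A (B - A) hreach hK hp hq hlt hFP hFQ
    · exact abs_signedDistance_left_le hF hreg hcpt A (B - A) hreach hK hq hp hlt hFQ hFP
  exact max_le (key A B (hh.trans (norm_sub_rev A B)) htwice)
    (key B A hh (by rwa [segment_symm]))
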